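/- Let $k,n,m\ge 2$ be integers and let $$W_{k,n,m}=\langle r_1,r_2,r_3 \mid r_1^2=r_2^2=r_3^2=(r_1r_2)^k=(r_2r_3)^n=(r_3r_1)^m=1\rangle .$$ Let $W_{k,n,m}^+\subseteq W_{k,n,m}$ be its alternating subgroup, i.e. the subgroup of all elements whose length with respect to $\{r_1,r_2,r_3\}$ is even. Call a subgroup $H$ of a group $G$ maximal finite if $H$ is finite and every subgroup of $G$ strictly containing $H$ is infinite. If $W_{k,n,m}$ is infinite, then $W_{k,n,m}^+$ has exactly three conjugacy classes of maximal finite subgroups (conjugacy being taken in $W_{k,n,m}^+$), and these can be labelled so that the subgroups in the first, second and third class are cyclic of order $k$, $n$ and $m$, respectively. -/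

import Mathlib

namespace TriangleCoxeter

/-- The alternating subgroup `W⁺` of a Coxeter group `W`: the elements of even length. -/
def alternatingSubgroup {B : Type*} {M : CoxeterMatrix B} {W : Type*} [Group W]
    (cs : CoxeterSystem M W) : Subgroup W where
  carrier := {w | Even (cs.length w)}
  mul_mem' := by
    intro a b ha hb
    have h := cs.length_mul_mod_two a b
    simp only [Set.mem_setOf_eq, Nat.even_iff] at *
    omega
  one_mem' := by simp
  inv_mem' := by
    intro a ha
    simpa using ha

/-- The Coxeter matrix of rank three with `m(r₁, r₂) = k`, `m(r₂, r₃) = n`, `m(r₃, r₁) = m`. -/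
def matrix (k n m : ℕ) (hk : 2 ≤ k) (hn : 2 ≤ n) (hm : 2 ≤ m) : CoxeterMatrix (Fin 3) where
  M := !![1, k, m; k, 1, n; m, n, 1]
  isSymm := by
    apply Matrix.IsSymm.ext
    intro i j
    fin_cases i <;> fin_cases j <;> rfl
  diagonal := by
    intro i
    fin_cases i <;> rfl
  off_diagonal := by
    intro i j h
    fin_cases i <;> fin_cases j <;> simp at h ⊢ <;> omega

/-- The Coxeter group `W_{k,n,m}`: generators `r₁, r₂, r₃`, relations
`r₁² = r₂² = r₃² = (r₁r₂)^k = (r₂r₃)^n = (r₃r₁)^m = 1`. -/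
abbrev W (k n m : ℕ) (hk : 2 ≤ k) (hn : 2 ≤ n) (hm : 2 ≤ m) : Type :=
  (matrix k n m hk hn hm).Group

/-- The alternating subgroup of `W_{k,n,m}`. -/
def Wplus (k n m : ℕ) (hk : 2 ≤ k) (hn : 2 ≤ n) (hm : 2 ≤ m) : Subgroup (W k n m hk hn hm) :=
  alternatingSubgroup (matrix k n m hk hn hm).toCoxeterSystem

/-- A subgroup is maximal finite if it is finite and every strictly larger subgroup is infinite. -/
def IsMaximalFinite {G : Type*} [Group G] (H : Subgroup G) : Prop :=
  Finite H ∧ ∀ H' : Subgroup G, H < H' → Infinite H'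

/-- The conjugacy class `{gHg⁻¹ | g ∈ G}` of a subgroup `H`. -/
def conjClass {G : Type*} [Group G] (H : Subgroup G) : Set (Subgroup G) :=
  {K | ∃ g : G, K = H.map (MulAut.conj g).toMonoidHom}

/-- The set of conjugacy classes of maximal finite subgroups of `G`. -/
def maximalFiniteClasses (G : Type*) [Group G] : Set (Set (Subgroup G)) :=
  {C | ∃ H : Subgroup G, IsMaximalFinite H ∧ C = conjClass H}

end TriangleCoxeter

/-! Let `W` act on `B → ℝ` by the reflections of the cosine form, and dually on functionals. Every
root is nonnegative or nonpositive (`geometricRep_single_nonneg`). The Tits cone, taken as the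
functionals negative on finitely many positive roots, is therefore visibly a convex cone; it is
`W`-stable, and the dominant functionals are a strict fundamental domain in it, with standard
parabolic stabilizers.

Existence: for `H` finite, sum the `H`-orbit of a strictly dominant `p`. The sum is nonzero, since
otherwise `-p` would lie in the cone, although it is negative on all of the infinitely many positive
roots. Moving this fixed point to a dominant one conjugates `H` into a proper parabolic. In rank
three the even part of a parabolic on two generators is generated by a rotation.

Separation: the `i`-th rotation fixes only the multiples of `proj i`, and no `g` carries `proj j` to
a multiple of `proj i` when `i ≠ j`. The argument uses only that `W` is infinite, so Euclidean and
hyperbolic triangles need no distinction. -/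

namespace CoxeterMatrix

/-! ### The geometric representation: reflections and their braid relations -/

open Real

variable {B : Type*} [Fintype B] [DecidableEq B] (M : CoxeterMatrix B)

/-- The cosine matrix of a Coxeter matrix. -/
noncomputable def cosineMatrix : Matrix B B ℝ := Matrix.of fun i j ↦ -cos (π / M i j)

/-- The canonical symmetric bilinear form of a Coxeter matrix. -/
noncomputable def cosineForm : LinearMap.BilinForm ℝ (B → ℝ) := Matrix.toBilin' M.cosineMatrix

@[simp] theorem cosineForm_single (i j : B) :
    M.cosineForm (Pi.single i 1) (Pi.single j 1) = -cos (π / M i j) := by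
  simp [cosineForm, cosineMatrix]

theorem cosineForm_single_self (i : B) :
    M.cosineForm (Pi.single i 1) (Pi.single i 1) = 1 := by
  simp

theorem cosineForm_comm (v w : B → ℝ) : M.cosineForm v w = M.cosineForm w v := by
  simp only [cosineForm, Matrix.toBilin'_apply, cosineMatrix, Matrix.of_apply]
  rw [Finset.sum_comm]
  refine Finset.sum_congr rfl fun i _ ↦ Finset.sum_congr rfl fun j _ ↦ ?_
  rw [M.symmetric j i]
  ring

/-- The reflection of the geometric representation attached to a simple generator. -/
noncomputable def simpleReflection (i : B) : Module.End ℝ (B → ℝ) :=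
  LinearMap.id - (2 : ℝ) • (M.cosineForm (Pi.single i 1)).smulRight (Pi.single i 1)

theorem simpleReflection_apply (i : B) (v : B → ℝ) :
    M.simpleReflection i v =
      v - (2 * M.cosineForm (Pi.single i 1) v) • (Pi.single i 1 : B → ℝ) := by
  simp [simpleReflection, smul_smul]

theorem simpleReflection_single_self (i : B) :
    M.simpleReflection i (Pi.single i 1) = -Pi.single i 1 := by
  rw [simpleReflection_apply, cosineForm_single_self]
  module

theorem simpleReflection_apply_of_ne (i j : B) (v : B → ℝ) (h : j ≠ i) :
    M.simpleReflection i v j = v j := by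
  simp [simpleReflection_apply, h]

theorem simpleReflection_mul_self (i : B) : M.simpleReflection i * M.simpleReflection i = 1 := by
  refine LinearMap.ext fun v ↦ ?_
  have := M.cosineForm_single_self i
  simp only [Module.End.mul_apply, simpleReflection_apply, map_sub, map_smul, this,
    Module.End.one_apply]
  module

theorem cosineForm_simpleReflection (i : B) (v : B → ℝ) :
    M.cosineForm (M.simpleReflection i v) (M.simpleReflection i v) = M.cosineForm v v := by
  have h1 := M.cosineForm_single_self i
  have h2 := M.cosineForm_comm v (Pi.single i 1)
  simp only [simpleReflection_apply, map_sub, map_smul, h1, h2, smul_eq_mul,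
    LinearMap.sub_apply, LinearMap.smul_apply]
  ring

/-- The action of a simple reflection on the plane spanned by two simple roots. -/
theorem simpleReflection_combination (i j : B) (a b : ℝ) :
    M.simpleReflection j (a • Pi.single i 1 + b • Pi.single j 1) =
      a • Pi.single i 1 + (2 * cos (π / M i j) * a - b) • (Pi.single j 1 : B → ℝ) := by
  rw [simpleReflection_apply, map_add, map_smul, map_smul, cosineForm_single_self,
    cosineForm_single, M.symmetric j i]
  simp only [smul_eq_mul]
  module

omit [Fintype B] [DecidableEq B] in
theorem sin_pi_div_pos {i j : B} (hij : i ≠ j) (h : M i j ≠ 0) : 0 < sin (π / M i j) := by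
  have h1 := M.off_diagonal i j hij
  have h2 : (2 : ℝ) ≤ M i j := by
    exact_mod_cast (by omega : 2 ≤ M i j)
  apply sin_pos_of_pos_of_lt_pi
  · have := pi_pos
    positivity
  · rw [div_lt_iff₀ (by linarith)]
    nlinarith [pi_pos]

/-- The factor `sin (π / M i j)` clears the denominators, and the induction is the recursion `2 cos
θ sin x = sin (x + θ) + sin (x - θ)`. The formula yields both the braid relation and the exact order
of the rotation. -/
theorem sin_smul_rotation_pow_left (i j : B) (q : ℕ) :
    sin (π / M i j) • ((M.simpleReflection i * M.simpleReflection j) ^ q) (Pi.single i 1) =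
      sin ((2 * q + 1) * (π / M i j)) • Pi.single i 1 +
        sin (2 * q * (π / M i j)) • (Pi.single j 1 : B → ℝ) := by
  induction q with
  | zero => simp
  | succ q ih =>
    rw [pow_succ', Module.End.mul_apply, ← map_smul, ih, Module.End.mul_apply,
      simpleReflection_combination, add_comm, simpleReflection_combination, M.symmetric j i,
      add_comm]
    have e1 : 2 * cos (π / M i j) * sin ((2 * q + 1) * (π / M i j)) - sin (2 * q * (π / M i j)) =
        sin (2 * (q + 1 : ℕ) * (π / M i j)) := by
      have h1 : (2 * (q + 1 : ℕ) * (π / M i j)) =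
        (2 * q + 1) * (π / M i j) + π / M i j := by push_cast; ring
      have h2 : (2 * q * (π / M i j)) = (2 * q + 1) * (π / M i j) - π / M i j := by ring
      rw [h1, h2, sin_add, sin_sub]
      ring
    have e2 : 2 * cos (π / M i j) * sin (2 * (q + 1 : ℕ) * (π / M i j)) -
        sin ((2 * q + 1) * (π / M i j)) = sin ((2 * (q + 1 : ℕ) + 1) * (π / M i j)) := by
      have h1 : ((2 * (q + 1 : ℕ) + 1) * (π / M i j)) =
        2 * (q + 1 : ℕ) * (π / M i j) + π / M i j := by push_cast; ring
      have h2 : ((2 * q + 1) * (π / M i j)) = 2 * (q + 1 : ℕ) * (π / M i j) - π / M i j := by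
        push_cast; ring
      rw [h1, h2, sin_add, sin_sub]
      ring
    rw [e1, e2]

theorem rotation_pow_mul_rotation_pow (i j : B) (q : ℕ) :
    (M.simpleReflection i * M.simpleReflection j) ^ q *
      (M.simpleReflection j * M.simpleReflection i) ^ q = 1 := by
  induction q with
  | zero => simp
  | succ q ih =>
    rw [pow_succ, pow_succ']
    calc _ = (M.simpleReflection i * M.simpleReflection j) ^ q * (M.simpleReflection i *
          (M.simpleReflection j * M.simpleReflection j) * M.simpleReflection i) *
          (M.simpleReflection j * M.simpleReflection i) ^ q := by simp only [mul_assoc]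
      _ = 1 := by rw [simpleReflection_mul_self, mul_one, simpleReflection_mul_self, mul_one, ih]

theorem rotation_pow_apply_single {i j : B} (hij : i ≠ j) (h : M i j ≠ 0) :
    ((M.simpleReflection i * M.simpleReflection j) ^ M i j) (Pi.single i 1) = Pi.single i 1 := by
  have hs := (M.sin_pi_div_pos hij h).ne'
  have h0 : (M i j : ℝ) ≠ 0 := by exact_mod_cast h
  have key := M.sin_smul_rotation_pow_left i j (M i j)
  have e1 : (2 * (M i j : ℝ) + 1) * (π / M i j) = π / M i j + 2 * π := by
    field_simp
    ring
  have e2 : 2 * (M i j : ℝ) * (π / M i j) = 2 * π := by field_simp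
  rw [e1, e2, sin_add_two_pi, sin_two_pi, zero_smul, add_zero] at key
  exact smul_right_injective _ hs key

/-- The form is nondegenerate on the plane of the two simple roots, so every vector splits into a
part in that plane and a part orthogonal to it; both reflections fix the latter. -/
theorem isLiftable_simpleReflection (hM : ∀ i j, M i j ≠ 0) :
    M.IsLiftable M.simpleReflection := by
  intro i j
  by_cases hij : i = j
  · subst hij
    simp [simpleReflection_mul_self]
  have hs := (M.sin_pi_div_pos hij (hM i j)).ne'
  have hsq := sin_sq_add_cos_sq (π / M i j)
  have h1 := M.rotation_pow_apply_single hij (hM i j)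
  have h2 : ((M.simpleReflection i * M.simpleReflection j) ^ M i j) (Pi.single j 1) =
      Pi.single j 1 := by
    have := M.rotation_pow_apply_single (Ne.symm hij) (hM j i)
    rw [M.symmetric j i] at this
    conv_lhs => rw [← this]
    rw [← Module.End.mul_apply, rotation_pow_mul_rotation_pow, Module.End.one_apply]
  refine LinearMap.ext fun v ↦ ?_
  set c := cos (π / M i j) with hc
  set s := sin (π / M i j)
  set x := M.cosineForm (Pi.single i 1) v with hx
  set y := M.cosineForm (Pi.single j 1) v with hy
  -- Solution of `a - c b = x`, `b - c a = y`, which makes `u` orthogonal to both roots; the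
  -- determinant is `1 - c² = s²`.
  set a := (x + c * y) / s ^ 2 with ha
  set b := (y + c * x) / s ^ 2 with hb
  set u := v - a • Pi.single i 1 - b • (Pi.single j 1 : B → ℝ) with hu
  have hs2 : s ^ 2 ≠ 0 := pow_ne_zero 2 hs
  have ui : M.cosineForm (Pi.single i 1) u = 0 := by
    rw [hu, map_sub, map_sub, map_smul, map_smul, cosineForm_single_self, cosineForm_single,
      ← hx, ← hc, ha, hb]
    simp only [smul_eq_mul]
    field_simp
    linear_combination x * hsq
  have uj : M.cosineForm (Pi.single j 1) u = 0 := by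
    rw [hu, map_sub, map_sub, map_smul, map_smul, cosineForm_single_self, cosineForm_single,
      ← hy, M.symmetric j i, ← hc, ha, hb]
    simp only [smul_eq_mul]
    field_simp
    linear_combination y * hsq
  have fixed : ∀ q : ℕ, ((M.simpleReflection i * M.simpleReflection j) ^ q) u = u := by
    intro q
    induction q with
    | zero => simp
    | succ q ih =>
      rw [pow_succ, Module.End.mul_apply, Module.End.mul_apply, simpleReflection_apply _ j, uj,
        mul_zero, zero_smul, sub_zero, simpleReflection_apply _ i, ui, mul_zero, zero_smul,
        sub_zero, ih]
  have hv : v = u + a • Pi.single i 1 + b • (Pi.single j 1 : B → ℝ) := by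
    rw [hu]; abel
  rw [hv, map_add, map_add, map_smul, map_smul, fixed, h1, h2, Module.End.one_apply]

end CoxeterMatrix

/-! ### Length and the sign of roots -/

namespace CoxeterSystem

open Real CoxeterMatrix

variable {B : Type*} [Fintype B] [DecidableEq B] {M : CoxeterMatrix B} {W : Type*} [Group W]
  (cs : CoxeterSystem M W) (hM : ∀ i j, M i j ≠ 0)

/-- The geometric representation of a Coxeter group all of whose labels are finite. -/
noncomputable def geometricRep : Representation ℝ W (B → ℝ) :=
  cs.lift ⟨M.simpleReflection, M.isLiftable_simpleReflection hM⟩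

@[simp] theorem geometricRep_simple (i : B) :
    cs.geometricRep hM (cs.simple i) = M.simpleReflection i :=
  cs.lift_apply_simple _ i

theorem cosineForm_geometricRep (w : W) (v : B → ℝ) :
    M.cosineForm (cs.geometricRep hM w v) (cs.geometricRep hM w v) = M.cosineForm v v := by
  induction w using cs.simple_induction_left with
  | one => simp
  | mul_simple_left w i ih =>
    rw [map_mul, Module.End.mul_apply, geometricRep_simple, cosineForm_simpleReflection, ih]

theorem sin_smul_geometricRep_alternatingWord (i j : B) (q : ℕ) :
    sin (π / M i j) • cs.geometricRep hM (cs.wordProd (alternatingWord i j q)) (Pi.single i 1) =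
      sin ((q + 1) * (π / M i j)) • Pi.single (if Even q then i else j) 1 +
        sin (q * (π / M i j)) • (Pi.single (if Even q then j else i) 1 : B → ℝ) := by
  induction q with
  | zero => simp [alternatingWord]
  | succ q ih =>
    rw [alternatingWord_succ', wordProd_cons, map_mul, Module.End.mul_apply, ← map_smul, ih,
      geometricRep_simple]
    have e : 2 * cos (π / M i j) * sin ((q + 1) * (π / M i j)) - sin (q * (π / M i j)) =
        sin (((q + 1 : ℕ) + 1) * (π / M i j)) := by
      have h1 : (((q + 1 : ℕ) + 1) * (π / M i j)) =
        (q + 1) * (π / M i j) + π / M i j := by push_cast; ring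
      have h2 : (q * (π / M i j)) = (q + 1) * (π / M i j) - π / M i j := by ring
      rw [h1, h2, sin_add, sin_sub]
      ring
    have e' : 2 * cos (π / M j i) * sin ((q + 1) * (π / M i j)) - sin (q * (π / M i j)) =
        sin (((q + 1 : ℕ) + 1) * (π / M i j)) := by rw [M.symmetric j i, e]
    by_cases hq : Even q
    · simp only [hq, if_true, Nat.even_add_one, not_true, if_false]
      rw [simpleReflection_combination, e, add_comm]
      push_cast
      rfl
    · simp only [hq, if_false, Nat.even_add_one, not_false_iff, if_true]
      rw [simpleReflection_combination, e', add_comm]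
      push_cast
      rfl

omit [Fintype B] [DecidableEq B] in
/-- Along an alternating word whose letters are stripped off the right of `w`, as long as the
length drops at each step. -/
theorem length_mul_alternatingWord_inv_mono {w : W} {i j : B} {q : ℕ}
    (h : cs.length (w * (cs.wordProd (alternatingWord i j (q + 1)))⁻¹) + (q + 1) = cs.length w) :
    cs.length (w * (cs.wordProd (alternatingWord i j q))⁻¹) + q = cs.length w := by
  rw [alternatingWord_succ', wordProd_cons, mul_inv_rev, inv_simple, ← mul_assoc] at h
  have h1 := cs.length_mul_le (w * (cs.wordProd (alternatingWord i j q))⁻¹)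
    (cs.wordProd (alternatingWord i j q))
  have h2 := cs.length_wordProd_le (alternatingWord i j q)
  rw [inv_mul_cancel_right] at h1
  rw [length_alternatingWord] at h2
  have h3 := cs.length_mul_simple (w * (cs.wordProd (alternatingWord i j q))⁻¹)
    (if Even q then j else i)
  omega

/-- Strip letters `j, i, j, …` off the right of `w` while the length drops. The remaining `v` is
lengthened by both reflections, so induction applies to it, and the stripped word, shorter than `M i
j`, sends the root `i` to a nonnegative combination of the roots `i` and `j`. -/
theorem geometricRep_single_nonneg {w : W} {i : B}
    (h : cs.length w < cs.length (w * cs.simple i)) :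
    0 ≤ cs.geometricRep hM w (Pi.single i 1) := by
  induction hn : cs.length w using Nat.strong_induction_on generalizing w i with
  | _ n ih =>
  subst hn
  by_cases hw : w = 1
  · subst hw
    simp
  obtain ⟨j, hj⟩ := cs.exists_rightDescent_of_ne_one hw
  have hij : i ≠ j := by
    rintro rfl
    exact absurd hj (by simp only [IsRightDescent]; omega)
  let P : ℕ → Prop := fun q ↦
    cs.length (w * (cs.wordProd (alternatingWord i j q))⁻¹) + q = cs.length w
  have hP1 : P 1 := by
    have := cs.isRightDescent_iff.mp hj
    simpa [P, alternatingWord] using this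
  have hPlt : ∀ q, P q → q ≤ cs.length w := fun q hq ↦ by simp only [P] at hq; omega
  classical
  obtain ⟨q, hq1, hPq, hPq'⟩ : ∃ q, 1 ≤ q ∧ P q ∧ ¬ P (q + 1) := by
    refine ⟨Nat.findGreatest P (cs.length w), Nat.le_findGreatest (hPlt 1 hP1) hP1,
      Nat.findGreatest_spec (hPlt 1 hP1) hP1, fun h' ↦ ?_⟩
    have := Nat.le_findGreatest (hPlt _ h') h'
    omega
  have mono : ∀ r, r ≤ q → P r := by
    intro r hr
    induction hr using Nat.decreasingInduction with
    | self => exact hPq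
    | of_succ r _ ih' => exact cs.length_mul_alternatingWord_inv_mono ih'
  -- Otherwise the braid relation makes the stripped word end in `i`, so `i` would shorten `w`.
  have hqM : q < M i j := by
    by_contra! hle
    have hPM := mono _ hle
    have hb := cs.wordProd_braidWord_eq i j
    simp only [braidWord] at hb
    rw [M.symmetric j i] at hb
    obtain ⟨r, hr⟩ : ∃ r, M i j = r + 1 := ⟨M i j - 1, by have := hM i j; omega⟩
    simp only [P] at hPM
    rw [hb, hr, alternatingWord_succ, wordProd_concat] at hPM
    have h1 := cs.length_mul_le
      (w * (cs.wordProd (alternatingWord i j r) * cs.simple i)⁻¹)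
      (cs.wordProd (alternatingWord i j r))
    have h2 := cs.length_wordProd_le (alternatingWord i j r)
    rw [length_alternatingWord] at h2
    rw [mul_inv_rev, inv_simple, mul_assoc, mul_assoc, inv_mul_cancel, mul_one] at h1
    rw [mul_inv_rev, inv_simple] at hPM
    omega
  set v := w * (cs.wordProd (alternatingWord i j q))⁻¹ with hv
  have hvq : cs.length v + q = cs.length w := hPq
  have hvw : cs.length v < cs.length w := by omega
  obtain ⟨r, hr⟩ : ∃ r, q = r + 1 := ⟨q - 1, by omega⟩
  -- This is the next letter to strip: it cannot shorten `v`, by maximality of `q`. The other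
  -- letter, in `hy`, is the last one stripped.
  have hx : cs.length v < cs.length (v * cs.simple (if Even q then j else i)) := by
    rcases cs.length_mul_simple v (if Even q then j else i) with h' | h'
    · omega
    · exfalso
      apply hPq'
      simp only [P]
      rw [alternatingWord_succ', wordProd_cons, mul_inv_rev, inv_simple, ← mul_assoc, ← hv]
      omega
  have hy : cs.length v < cs.length (v * cs.simple (if Even q then i else j)) := by
    have hPr := mono r (by omega)
    have e : v * cs.simple (if Even q then i else j) =
        w * (cs.wordProd (alternatingWord i j r))⁻¹ := by
      rw [hv, hr, alternatingWord_succ', wordProd_cons, mul_inv_rev, inv_simple]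
      by_cases hr' : Even r <;> simp [hr', Nat.even_add_one, ← mul_assoc]
    rw [e]
    simp only [P] at hPr
    omega
  have px := ih _ hvw hx rfl
  have py := ih _ hvw hy rfl
  have hwv : w = v * cs.wordProd (alternatingWord i j q) := by simp [hv]
  have key := congrArg (cs.geometricRep hM v)
    (cs.sin_smul_geometricRep_alternatingWord hM i j q)
  rw [map_smul, ← Module.End.mul_apply, ← map_mul, ← hwv, map_add, map_smul, map_smul] at key
  have hs := M.sin_pi_div_pos hij (hM i j)
  have hM0 : (0 : ℝ) < M i j := by exact_mod_cast Nat.pos_of_ne_zero (hM i j)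
  have bound : ∀ r : ℕ, r ≤ M i j → 0 ≤ sin (r * (π / M i j)) := by
    intro r hr
    apply sin_nonneg_of_nonneg_of_le_pi
    · have := pi_pos
      positivity
    · have : (r : ℝ) ≤ M i j := by exact_mod_cast hr
      calc r * (π / M i j) ≤ M i j * (π / M i j) := by
            have := pi_pos
            gcongr
        _ = π := by field_simp
  have b1 := bound (q + 1) hqM
  have b2 := bound q hqM.le
  push_cast at b1
  have hnn : 0 ≤ sin (π / M i j) • cs.geometricRep hM w (Pi.single i 1) := by
    rw [key]
    exact add_nonneg (smul_nonneg b1 py) (smul_nonneg b2 px)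
  exact fun l ↦ nonneg_of_mul_nonneg_right (by simpa using hnn l) hs

end CoxeterSystem

/-! ### Positive roots -/

namespace CoxeterSystem

open CoxeterMatrix Module

variable {B : Type*} [Fintype B] [DecidableEq B] {M : CoxeterMatrix B} {W : Type*} [Group W]
  (cs : CoxeterSystem M W) (hM : ∀ i j, M i j ≠ 0)

theorem geometricRep_single_nonpos {w : W} {i : B}
    (h : cs.length (w * cs.simple i) < cs.length w) :
    cs.geometricRep hM w (Pi.single i 1) ≤ 0 := by
  have := cs.geometricRep_single_nonneg hM (w := w * cs.simple i) (i := i) (by simpa using h)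
  rwa [map_mul, Module.End.mul_apply, geometricRep_simple, simpleReflection_single_self, map_neg,
    le_neg, neg_zero] at this

theorem geometricRep_inv_apply (w : W) (v : B → ℝ) :
    cs.geometricRep hM w⁻¹ (cs.geometricRep hM w v) = v := by
  simp [← Module.End.mul_apply, ← map_mul]

theorem geometricRep_injective (w : W) : Function.Injective (cs.geometricRep hM w) :=
  Function.LeftInverse.injective (cs.geometricRep_inv_apply hM w)

/-- The positive roots: the nonnegative vectors in the orbits of the simple roots. -/
def positiveRoots : Set (B → ℝ) :=
  {β | 0 ≤ β ∧ ∃ w i, β = cs.geometricRep hM w (Pi.single i 1)}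

variable {cs hM}

theorem single_mem_positiveRoots (i : B) : Pi.single i 1 ∈ cs.positiveRoots hM :=
  ⟨by simp, 1, i, by simp⟩

theorem mem_or_neg_mem_positiveRoots (w : W) (i : B) :
    cs.geometricRep hM w (Pi.single i 1) ∈ cs.positiveRoots hM ∨
      -cs.geometricRep hM w (Pi.single i 1) ∈ cs.positiveRoots hM := by
  rcases cs.length_mul_simple w i with h | h
  · exact .inl ⟨cs.geometricRep_single_nonneg hM (by omega), w, i, rfl⟩
  · refine .inr ⟨neg_nonneg.mpr (cs.geometricRep_single_nonpos hM (by omega)), w * cs.simple i, i,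
      ?_⟩
    rw [map_mul, Module.End.mul_apply, geometricRep_simple, simpleReflection_single_self, map_neg]

theorem ne_zero_of_mem_positiveRoots {β : B → ℝ} (h : β ∈ cs.positiveRoots hM) : β ≠ 0 := by
  obtain ⟨-, w, i, rfl⟩ := h
  rw [Ne, map_eq_zero_iff _ (cs.geometricRep_injective hM w)]
  simp

/-- The reflection changes only coordinate `i`. If the image were negative, `β` would be a multiple
of the simple root, and roots have norm one. -/
theorem simpleReflection_mem_positiveRoots {β : B → ℝ} {i : B} (h : β ∈ cs.positiveRoots hM)
    (hi : β ≠ Pi.single i 1) : M.simpleReflection i β ∈ cs.positiveRoots hM := by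
  obtain ⟨h0, w, j, hβ⟩ := h
  have e : M.simpleReflection i β =
      cs.geometricRep hM (cs.simple i * w) (Pi.single j 1) := by
    rw [map_mul, Module.End.mul_apply, geometricRep_simple, hβ]
  rcases mem_or_neg_mem_positiveRoots (hM := hM) (cs := cs) (cs.simple i * w) j with h | h
  · rwa [e]
  exfalso
  rw [← e] at h
  have hz : ∀ l, l ≠ i → β l = 0 := by
    intro l hl
    have h1 := h.1 l
    rw [Pi.neg_apply, M.simpleReflection_apply_of_ne i l β hl] at h1
    have h2 := h0 l
    simp only [Pi.zero_apply] at h1 h2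
    linarith
  have hβi : β = β i • (Pi.single i 1 : B → ℝ) := by
    ext l
    by_cases hl : l = i
    · subst hl; simp
    · simp [hl, hz l hl]
  have hn := cs.cosineForm_geometricRep hM w (Pi.single j 1)
  rw [← hβ, hβi, map_smul, map_smul, LinearMap.smul_apply, cosineForm_single_self,
    cosineForm_single_self] at hn
  simp only [smul_eq_mul, mul_one] at hn
  have h2 := h0 i
  simp only [Pi.zero_apply] at h2
  have : β i = 1 := by nlinarith
  rw [this, one_smul] at hβi
  exact hi hβi

theorem eq_one_of_geometricRep_single_eq {w : W}
    (h : ∀ i, cs.geometricRep hM w (Pi.single i 1) = Pi.single i 1) : w = 1 := by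
  by_contra hw
  obtain ⟨i, hi⟩ := cs.exists_rightDescent_of_ne_one hw
  have h1 := cs.geometricRep_single_nonpos hM hi
  rw [h i] at h1
  have h2 := h1 i
  simp only [Pi.single_eq_same, Pi.zero_apply] at h2
  linarith

/-- An element of `W` is determined by its values on the simple roots, which are roots up to sign.
-/
theorem infinite_positiveRoots [Infinite W] : (cs.positiveRoots hM).Infinite := by
  intro hfin
  have hf : (cs.positiveRoots hM ∪ Neg.neg ⁻¹' cs.positiveRoots hM).Finite :=
    hfin.union (hfin.preimage neg_injective.injOn)
  have := hf.to_subtype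
  let f : W → B → ↑(cs.positiveRoots hM ∪ Neg.neg ⁻¹' cs.positiveRoots hM) :=
    fun w i ↦ ⟨cs.geometricRep hM w (Pi.single i 1), mem_or_neg_mem_positiveRoots w i⟩
  have hinj : Function.Injective f := by
    intro w w' h
    have h1 : w⁻¹ * w' = 1 := by
      refine eq_one_of_geometricRep_single_eq (cs := cs) (hM := hM) fun i ↦ ?_
      have h2 := congrArg Subtype.val (congrFun h i)
      simp only [f] at h2
      rw [map_mul, Module.End.mul_apply, ← h2, geometricRep_inv_apply]
    exact inv_mul_eq_one.mp h1
  exact not_finite_iff_infinite.mpr ‹_› (Finite.of_injective f hinj)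

/-! ### The Tits cone and its fundamental domain -/

variable (cs hM)

/-- The Tits cone, described as the functionals negative on only finitely many positive roots. -/
def titsCone : Set (Dual ℝ (B → ℝ)) :=
  {x | {β ∈ cs.positiveRoots hM | x β < 0}.Finite}

variable {cs hM}

theorem apply_nonneg_of_dominant {x : Dual ℝ (B → ℝ)} (h : ∀ i, 0 ≤ x (Pi.single i 1))
    {v : B → ℝ} (hv : 0 ≤ v) : 0 ≤ x v := by
  rw [LinearMap.pi_apply_eq_sum_univ x v]
  refine Finset.sum_nonneg fun i _ ↦ smul_nonneg (hv i) ?_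
  have e : (fun j ↦ if i = j then (1 : ℝ) else 0) = Pi.single i 1 := by
    ext j
    simp [Pi.single_apply, eq_comm]
  exact e ▸ h i

theorem dominant_mem_titsCone {x : Dual ℝ (B → ℝ)} (h : ∀ i, 0 ≤ x (Pi.single i 1)) :
    x ∈ cs.titsCone hM := by
  refine Set.finite_empty.subset fun β hβ ↦ ?_
  exact absurd (apply_nonneg_of_dominant h hβ.1.1) (not_le.mpr hβ.2)

theorem add_mem_titsCone {x y : Dual ℝ (B → ℝ)} (hx : x ∈ cs.titsCone hM)
    (hy : y ∈ cs.titsCone hM) : x + y ∈ cs.titsCone hM := by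
  refine (Set.Finite.union hx hy).subset fun β ⟨h1, h2⟩ ↦ ?_
  by_contra! h
  simp only [Set.mem_union, Set.mem_ofPred_eq, h1, true_and, not_or, not_lt] at h
  rw [LinearMap.add_apply] at h2
  linarith

theorem smul_mem_titsCone {x : Dual ℝ (B → ℝ)} (hx : x ∈ cs.titsCone hM) {c : ℝ} (hc : 0 ≤ c) :
    c • x ∈ cs.titsCone hM := by
  refine Set.Finite.subset hx fun β ⟨h1, h2⟩ ↦ ⟨h1, ?_⟩
  rw [LinearMap.smul_apply, smul_eq_mul] at h2
  by_contra! h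
  exact absurd (mul_nonneg hc h) (not_le.mpr h2)

theorem sum_mem_titsCone {ι : Type*} (s : Finset ι) {x : ι → Dual ℝ (B → ℝ)}
    (hx : ∀ i ∈ s, x i ∈ cs.titsCone hM) : ∑ i ∈ s, x i ∈ cs.titsCone hM := by
  classical
  induction s using Finset.induction_on with
  | empty => exact dominant_mem_titsCone (by simp)
  | insert a s ha ih =>
    rw [Finset.sum_insert ha]
    exact add_mem_titsCone (hx a (Finset.mem_insert_self a s))
      (ih fun i hi ↦ hx i (Finset.mem_insert_of_mem hi))

theorem dual_apply_apply (w : W) (x : Dual ℝ (B → ℝ)) (v : B → ℝ) :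
    (cs.geometricRep hM).dual w x v = x (cs.geometricRep hM w⁻¹ v) := rfl

theorem dual_simple_apply (i : B) (x : Dual ℝ (B → ℝ)) (v : B → ℝ) :
    (cs.geometricRep hM).dual (cs.simple i) x v = x (M.simpleReflection i v) := by
  rw [dual_apply_apply, inv_simple, geometricRep_simple]

theorem simpleReflection_simpleReflection (i : B) (v : B → ℝ) :
    M.simpleReflection i (M.simpleReflection i v) = v := by
  rw [← Module.End.mul_apply, simpleReflection_mul_self, Module.End.one_apply]

theorem dual_mem_titsCone (w : W) {x : Dual ℝ (B → ℝ)} (hx : x ∈ cs.titsCone hM) :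
    (cs.geometricRep hM).dual w x ∈ cs.titsCone hM := by
  induction w using cs.simple_induction_left with
  | one => rwa [map_one, Module.End.one_apply]
  | mul_simple_left w i ih =>
    rw [map_mul, Module.End.mul_apply]
    refine ((Set.finite_singleton (Pi.single i 1)).union (Set.Finite.image (M.simpleReflection i)
      ih)).subset fun β ⟨h1, h2⟩ ↦ ?_
    by_cases hβ : β = Pi.single i 1
    · exact .inl hβ
    · exact .inr ⟨M.simpleReflection i β, ⟨simpleReflection_mem_positiveRoots h1 hβ,
        by rwa [dual_simple_apply] at h2⟩, simpleReflection_simpleReflection i β⟩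

/-- Reflecting in a simple root on which `x` is negative removes that root from the finite set of
negative positive roots and permutes the others. -/
theorem exists_dual_dominant {x : Dual ℝ (B → ℝ)} (hx : x ∈ cs.titsCone hM) :
    ∃ w, ∀ i, 0 ≤ (cs.geometricRep hM).dual w x (Pi.single i 1) := by
  induction hn : {β ∈ cs.positiveRoots hM | x β < 0}.ncard using Nat.strong_induction_on
    generalizing x with
  | _ n ih =>
  by_cases hdom : ∀ i, 0 ≤ x (Pi.single i 1)
  · exact ⟨1, by rwa [map_one, Module.End.one_apply]⟩
  push Not at hdom
  obtain ⟨i, hi⟩ := hdom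
  have hsub : M.simpleReflection i ''
      {β ∈ cs.positiveRoots hM | (cs.geometricRep hM).dual (cs.simple i) x β < 0} ⊂
      {β ∈ cs.positiveRoots hM | x β < 0} := by
    have hne : ∀ β, (cs.geometricRep hM).dual (cs.simple i) x β < 0 → β ≠ Pi.single i 1 := by
      rintro β hβ rfl
      rw [dual_simple_apply, simpleReflection_single_self, map_neg] at hβ
      linarith
    refine Set.ssubset_iff_of_subset ?_ |>.mpr
      ⟨Pi.single i 1, ⟨single_mem_positiveRoots i, hi⟩, ?_⟩
    · rintro _ ⟨β, ⟨h1, h2⟩, rfl⟩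
      exact ⟨simpleReflection_mem_positiveRoots h1 (hne β h2), by rwa [dual_simple_apply] at h2⟩
    · rintro ⟨β, ⟨h1, h2⟩, h3⟩
      have h4 : β = -Pi.single i 1 := by
        rw [← simpleReflection_simpleReflection (M := M) i β, h3, simpleReflection_single_self]
      have h5 := h1.1 i
      rw [h4] at h5
      simp only [Pi.zero_apply, Pi.neg_apply, Pi.single_eq_same] at h5
      linarith
  have hlt := Set.ncard_lt_ncard hsub hx
  rw [Set.ncard_image_of_injective _
    (Function.LeftInverse.injective (simpleReflection_simpleReflection i)), hn] at hlt
  obtain ⟨w, hw⟩ := ih _ hlt (dual_mem_titsCone _ hx) rfl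
  exact ⟨w * cs.simple i, by simpa [map_mul, Module.End.mul_apply] using hw⟩

/-- Dominant functionals form a strict fundamental domain, and their stabilizers are standard
parabolic subgroups. -/
theorem dual_eq_self_of_dominant {z : Dual ℝ (B → ℝ)} {w : W} (hz : ∀ i, 0 ≤ z (Pi.single i 1))
    (hw : ∀ i, 0 ≤ (cs.geometricRep hM).dual w z (Pi.single i 1)) :
    (cs.geometricRep hM).dual w z = z ∧
      w ∈ Subgroup.closure (cs.simple '' {i | z (Pi.single i 1) = 0}) := by
  induction hn : cs.length w using Nat.strong_induction_on generalizing w with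
  | _ n ih =>
  by_cases h1 : w = 1
  · subst h1
    exact ⟨by rw [map_one, Module.End.one_apply], one_mem _⟩
  obtain ⟨i, hi⟩ := cs.exists_leftDescent_of_ne_one h1
  have hi' : cs.length (w⁻¹ * cs.simple i) < cs.length w⁻¹ :=
    cs.isRightDescent_inv_iff.mpr hi
  -- A left descent `i` makes `w⁻¹` of the simple root nonpositive, so `w z` is at most zero there.
  -- By dominance it vanishes, and the reflection fixes `w z`.
  have hneg := apply_nonneg_of_dominant hz
    (neg_nonneg.mpr (cs.geometricRep_single_nonpos hM hi'))
  rw [map_neg] at hneg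
  have hzero : (cs.geometricRep hM).dual w z (Pi.single i 1) = 0 :=
    le_antisymm (by rw [dual_apply_apply]; linarith) (hw i)
  have hfix : (cs.geometricRep hM).dual (cs.simple i * w) z = (cs.geometricRep hM).dual w z := by
    rw [map_mul, Module.End.mul_apply]
    refine LinearMap.ext fun v ↦ ?_
    rw [dual_simple_apply, simpleReflection_apply, map_sub, map_smul, hzero, smul_zero, sub_zero]
  obtain ⟨ha, hb⟩ := ih (cs.length (cs.simple i * w)) (hn ▸ hi) (w := cs.simple i * w)
    (by rwa [hfix]) rfl
  have hwz := hfix.symm.trans ha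
  refine ⟨hwz, ?_⟩
  rw [hwz] at hzero
  have := Subgroup.mul_mem _ (Subgroup.subset_closure (Set.mem_image_of_mem cs.simple hzero)) hb
  simpa using this

theorem neg_notMem_titsCone [Infinite W] {p : Dual ℝ (B → ℝ)}
    (hp : ∀ i, 0 < p (Pi.single i 1)) : -p ∉ cs.titsCone hM := by
  intro h
  refine infinite_positiveRoots (cs := cs) (hM := hM) (Set.Finite.subset h fun β hβ ↦ ⟨hβ, ?_⟩)
  have hβ0 := ne_zero_of_mem_positiveRoots hβ
  obtain ⟨i, hi⟩ := Function.ne_iff.mp hβ0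
  have hpos : 0 < β i := lt_of_le_of_ne (hβ.1 i) (Ne.symm hi)
  have h2 := apply_nonneg_of_dominant (x := p) (fun i ↦ (hp i).le)
    (v := β - β i • Pi.single i 1) fun j ↦ by
      by_cases hj : j = i
      · subst hj; simp
      · simpa [hj] using hβ.1 j
  rw [map_sub, map_smul, smul_eq_mul] at h2
  have := mul_pos hpos (hp i)
  rw [LinearMap.neg_apply]
  linarith

/-! ### Finite subgroups and parabolic subgroups -/

/-- The sum of all coordinates. -/
noncomputable def coordinateSum (B : Type*) [Fintype B] : Dual ℝ (B → ℝ) :=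
  ∑ i, LinearMap.proj i

theorem coordinateSum_single (i : B) : coordinateSum B (Pi.single i 1) = 1 := by
  simp [coordinateSum]

theorem dual_orbitSum (H : Subgroup W) [Fintype H] (x : Dual ℝ (B → ℝ)) {g : W} (hg : g ∈ H) :
    (cs.geometricRep hM).dual g (∑ h : H, (cs.geometricRep hM).dual (h : W) x) =
      ∑ h : H, (cs.geometricRep hM).dual (h : W) x := by
  rw [map_sum]
  refine Fintype.sum_equiv (Equiv.mulLeft (⟨g, hg⟩ : H)) _ _ fun h ↦ ?_
  simp [map_mul, Module.End.mul_apply]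

/-- Removing the identity term leaves a sum of points of the cone. Hence a vanishing orbit sum would
put `-x` in the cone. -/
theorem orbitSum_sub_mem_titsCone (H : Subgroup W) [Fintype H] {x : Dual ℝ (B → ℝ)}
    (hx : x ∈ cs.titsCone hM) :
    ∑ h : H, (cs.geometricRep hM).dual (h : W) x - x ∈ cs.titsCone hM := by
  classical
  rw [← Finset.add_sum_erase _ _ (Finset.mem_univ (1 : H))]
  simp only [OneMemClass.coe_one, map_one, Module.End.one_apply, add_sub_cancel_left]
  exact sum_mem_titsCone _ fun h _ ↦ dual_mem_titsCone _ hx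

/-- A finite subgroup of an infinite Coxeter group is conjugate into a maximal standard parabolic
subgroup. -/
theorem exists_conj_mem_parabolic [Infinite W] (hM : ∀ i j, M i j ≠ 0) (H : Subgroup W)
    [Finite H] :
    ∃ (w : W) (l : B), ∀ h ∈ H,
      w * h * w⁻¹ ∈ Subgroup.closure (cs.simple '' {i | i ≠ l}) := by
  have := Fintype.ofFinite H
  set p := coordinateSum B
  have hp : ∀ i, p (Pi.single i 1) = 1 := coordinateSum_single
  have hpU : p ∈ cs.titsCone hM := dominant_mem_titsCone fun i ↦ by simp [hp]
  set y := ∑ h : H, (cs.geometricRep hM).dual (h : W) p with hy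
  have hyU : y ∈ cs.titsCone hM := sum_mem_titsCone _ fun h _ ↦ dual_mem_titsCone _ hpU
  have hy0 : y ≠ 0 := by
    intro h0
    have h1 := orbitSum_sub_mem_titsCone H hpU
    rw [← hy, h0, zero_sub] at h1
    exact neg_notMem_titsCone (fun i ↦ by simp [hp]) h1
  obtain ⟨w, hw⟩ := exists_dual_dominant hyU
  obtain ⟨l, hl⟩ : ∃ l, (cs.geometricRep hM).dual w y (Pi.single l 1) ≠ 0 := by
    by_contra! h0
    apply hy0
    have h1 : (cs.geometricRep hM).dual w y = 0 := by
      refine LinearMap.pi_ext' fun i ↦ LinearMap.ext_ring ?_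
      simpa using h0 i
    have h2 := congrArg ((cs.geometricRep hM).dual w⁻¹) h1
    rwa [← Module.End.mul_apply, ← map_mul, inv_mul_cancel, map_one, Module.End.one_apply,
      map_zero] at h2
  refine ⟨w, l, fun h hh ↦ ?_⟩
  have hfix : (cs.geometricRep hM).dual (w * h * w⁻¹) ((cs.geometricRep hM).dual w y) =
      (cs.geometricRep hM).dual w y := by
    rw [← Module.End.mul_apply, ← map_mul, inv_mul_cancel_right, map_mul, Module.End.mul_apply,
      dual_orbitSum H p hh]
  have hmem := (dual_eq_self_of_dominant hw (w := w * h * w⁻¹) (by rwa [hfix])).2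
  refine Subgroup.closure_mono (Set.image_mono ?_) hmem
  rintro i hi rfl
  exact hl hi

end CoxeterSystem

/-! ### Orders and fixed functionals of rotations -/

namespace CoxeterSystem

open Real CoxeterMatrix Module

variable {B : Type*} [Fintype B] [DecidableEq B] {M : CoxeterMatrix B} {W : Type*} [Group W]
  {cs : CoxeterSystem M W}

theorem orderOf_simple_mul_simple (hM : ∀ i j, M i j ≠ 0) {i j : B} (hij : i ≠ j) :
    orderOf (cs.simple i * cs.simple j) = M i j := by
  refine Nat.dvd_antisymm (orderOf_dvd_of_pow_eq_one (cs.simple_mul_simple_pow i j)) ?_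
  set q := orderOf (cs.simple i * cs.simple j)
  have hs := (M.sin_pi_div_pos hij (hM i j)).ne'
  have hM0 : (M i j : ℝ) ≠ 0 := by exact_mod_cast hM i j
  have h1 := congrArg (cs.geometricRep hM) (pow_orderOf_eq_one (cs.simple i * cs.simple j))
  rw [map_pow, map_mul, geometricRep_simple, geometricRep_simple, map_one] at h1
  have key := M.sin_smul_rotation_pow_left i j q
  rw [h1, Module.End.one_apply] at key
  have ki := congrFun key i
  have kj := congrFun key j
  simp only [Pi.smul_apply, Pi.add_apply, Pi.single_eq_same, Pi.single_eq_of_ne hij,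
    Pi.single_eq_of_ne hij.symm, smul_eq_mul, mul_zero, mul_one, add_zero, zero_add] at ki kj
  have e : (2 * (q : ℝ) + 1) * (π / M i j) = 2 * q * (π / M i j) + π / M i j := by ring
  rw [e, sin_add, ← kj, zero_mul, zero_add] at ki
  have hc : cos (2 * q * (π / M i j)) = 1 := mul_right_cancel₀ hs (by rw [← ki, one_mul])
  obtain ⟨z, hz⟩ := (cos_eq_one_iff _).mp hc
  have hz' : (q : ℝ) = M i j * z := by
    field_simp at hz
    nlinarith [pi_pos]
  have hz'' : (q : ℤ) = M i j * z := by exact_mod_cast hz'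
  exact Int.natCast_dvd_natCast.mp ⟨z, hz''⟩

/-- Both reflections move `x` to the same functional; evaluating at the two roots gives a linear
system whose determinant is a nonzero multiple of `sin²`. -/
theorem apply_eq_zero_of_dual_eq_self {hM : ∀ i j, M i j ≠ 0} {i j : B} (hij : i ≠ j)
    {x : Dual ℝ (B → ℝ)}
    (h : (cs.geometricRep hM).dual (cs.simple i * cs.simple j) x = x) :
    x (Pi.single i 1) = 0 ∧ x (Pi.single j 1) = 0 := by
  have h1 : ∀ v, x (M.simpleReflection i v) = x (M.simpleReflection j v) := by
    intro v
    have := LinearMap.congr_fun h (M.simpleReflection i v)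
    rwa [map_mul, Module.End.mul_apply, dual_simple_apply, dual_simple_apply,
      simpleReflection_simpleReflection, eq_comm] at this
  have hi := h1 (Pi.single i 1)
  have hj := h1 (Pi.single j 1)
  simp only [simpleReflection_single_self] at hi hj
  simp only [simpleReflection_apply, cosineForm_single, map_sub, map_neg, map_smul,
    smul_eq_mul, M.symmetric j i] at hi hj
  have hs := M.sin_pi_div_pos hij (hM i j)
  have hsq := sin_sq_add_cos_sq (π / M i j)
  have hxi : sin (π / M i j) ^ 2 * x (Pi.single i 1) = 0 := by
    linear_combination (-1 / 2) * hi + (-cos (π / M i j) / 2) * hj + x (Pi.single i 1) * hsq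
  have hxj : sin (π / M i j) ^ 2 * x (Pi.single j 1) = 0 := by
    linear_combination (1 / 2) * hj + (cos (π / M i j) / 2) * hi + x (Pi.single j 1) * hsq
  have hs2 := (pow_pos hs 2).ne'
  exact ⟨(mul_eq_zero.mp hxi).resolve_left hs2, (mul_eq_zero.mp hxj).resolve_left hs2⟩

theorem dual_proj_eq_self {hM : ∀ i j, M i j ≠ 0} {l : B} {w : W}
    (hw : w ∈ Subgroup.closure (cs.simple '' {i | i ≠ l})) :
    (cs.geometricRep hM).dual w (LinearMap.proj l) = LinearMap.proj l := by
  induction hw using Subgroup.closure_induction with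
  | mem w hw =>
    obtain ⟨i, hi, rfl⟩ := hw
    refine LinearMap.ext fun v ↦ ?_
    rw [dual_simple_apply]
    exact M.simpleReflection_apply_of_ne i l v (Ne.symm hi)
  | one => rw [map_one, Module.End.one_apply]
  | mul a b _ _ ha hb => rw [map_mul, Module.End.mul_apply, hb, ha]
  | inv a _ ha =>
    conv_lhs => rw [← ha]
    rw [← Module.End.mul_apply, ← map_mul, inv_mul_cancel, map_one, Module.End.one_apply]

end CoxeterSystem

/-! ### Conjugacy classes of maximal finite subgroups in general -/

namespace TriangleCoxeter

theorem maximalFiniteClasses_eq_range {G ι : Type*} [Group G] {A : ι → Subgroup G}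
    (hfin : ∀ i, Finite (A i))
    (hconj : ∀ H : Subgroup G, Finite H → ∃ i g, H ≤ (A i).map (MulAut.conj g).toMonoidHom)
    (hne : ∀ i j g, A i ≤ (A j).map (MulAut.conj g).toMonoidHom → i = j) :
    maximalFiniteClasses G = Set.range fun i ↦ conjClass (A i) := by
  have hmapfin : ∀ i g, Finite ((A i).map (MulAut.conj g).toMonoidHom) := fun i g ↦
    Finite.of_equiv _ ((A i).equivMapOfInjective _ (MulAut.conj g).injective).toEquiv
  ext C
  constructor
  · rintro ⟨H, ⟨hH, hmax⟩, rfl⟩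
    obtain ⟨i, g, hle⟩ := hconj H hH
    have heq : H = (A i).map (MulAut.conj g).toMonoidHom := by
      by_contra h
      have h1 := hmax _ (lt_of_le_of_ne hle h)
      have h2 := hmapfin i g
      exact not_finite_iff_infinite.mpr h1 h2
    refine ⟨i, Set.ext fun K ↦ ⟨?_, ?_⟩⟩
    · rintro ⟨a, rfl⟩
      refine ⟨a * g⁻¹, ?_⟩
      rw [heq, Subgroup.map_map]
      congr 1
      ext x
      simp [mul_assoc]
    · rintro ⟨a, rfl⟩
      refine ⟨a * g, ?_⟩
      rw [heq, Subgroup.map_map]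
      congr 1
      ext x
      simp [mul_assoc]
  · rintro ⟨i, rfl⟩
    refine ⟨A i, ⟨hfin i, fun H' hlt ↦ ?_⟩, rfl⟩
    by_contra hH'
    rw [not_infinite_iff_finite] at hH'
    obtain ⟨j, g, hle⟩ := hconj H' hH'
    obtain rfl := hne i j g (hlt.le.trans hle)
    have := hmapfin i g
    -- `H'` strictly contains `A i` and lies in a conjugate of it, which has the same finite
    -- cardinality.
    have h1 := Set.ncard_lt_ncard (SetLike.coe_ssubset_coe.mpr hlt) (Set.toFinite _)
    have h2 := Set.ncard_le_ncard (SetLike.coe_subset_coe.mpr hle) (Set.toFinite _)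
    simp only [← Nat.card_coe_set_eq, SetLike.coe_sort_coe] at h1 h2
    have h4 : Nat.card (A i) = Nat.card ((A i).map (MulAut.conj g).toMonoidHom) :=
      Nat.card_congr ((A i).equivMapOfInjective _ (MulAut.conj g).injective).toEquiv
    omega

theorem conjClass_injective {G ι : Type*} [Group G] {A : ι → Subgroup G}
    (hne : ∀ i j g, A i ≤ (A j).map (MulAut.conj g).toMonoidHom → i = j) :
    Function.Injective fun i ↦ conjClass (A i) := by
  intro i j h
  have hi : A i ∈ conjClass (A i) := ⟨1, by ext x; simp⟩
  obtain ⟨g, hg⟩ := (congrArg (A i ∈ ·) h).mp hi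
  exact hne i j g hg.le

theorem nonempty_mulEquiv_zmod {G : Type*} [Group G] {a : G} {q : ℕ} (hq : orderOf a = q)
    {H : Subgroup G} (hH : H ∈ conjClass (Subgroup.zpowers a)) :
    Nonempty (H ≃* Multiplicative (ZMod q)) := by
  obtain ⟨g, rfl⟩ := hH
  subst hq
  have e := (Subgroup.zpowers a).equivMapOfInjective (MulAut.conj g).toMonoidHom
    (MulAut.conj g).injective
  have e' := zmodCyclicMulEquiv (inferInstance : IsCyclic (Subgroup.zpowers a))
  rw [Nat.card_zpowers] at e'
  exact ⟨e.symm.trans e'.symm⟩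

/-! ### Rank three: rotations in the alternating subgroup -/

open CoxeterSystem CoxeterMatrix Module

variable {M : CoxeterMatrix (Fin 3)} {W : Type*} [Group W] (cs : CoxeterSystem M W)

/-- The rotation fixing the vertex of the fundamental triangle opposite to the `l`-th side. -/
def rotation (l : Fin 3) : W := cs.simple (l + 1) * cs.simple (l + 2)

theorem add_one_ne_add_two (l : Fin 3) : l + 1 ≠ l + 2 := by decide +revert

theorem eq_or_eq_add_one_or_eq_add_two (i l : Fin 3) : i = l ∨ i = l + 1 ∨ i = l + 2 := by
  decide +revert

theorem rotation_mem_closure (l : Fin 3) :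
    rotation cs l ∈ Subgroup.closure (cs.simple '' {i | i ≠ l}) :=
  mul_mem (Subgroup.subset_closure ⟨l + 1, by simp, rfl⟩)
    (Subgroup.subset_closure ⟨l + 2, by simp, rfl⟩)

theorem simple_notMem_alternatingSubgroup {B W : Type*} [Group W] {M : CoxeterMatrix B}
    (cs : CoxeterSystem M W) (i : B) : cs.simple i ∉ alternatingSubgroup cs := by
  change ¬ Even (cs.length (cs.simple i))
  simp

theorem simple_mul_mem_alternatingSubgroup {B W : Type*} [Group W] {M : CoxeterMatrix B}
    (cs : CoxeterSystem M W) (i : B) {w : W} (hw : w ∉ alternatingSubgroup cs) :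
    cs.simple i * w ∈ alternatingSubgroup cs := by
  change ¬ Even (cs.length w) at hw
  change Even (cs.length (cs.simple i * w))
  rw [Nat.even_iff, cs.length_mul_mod_two, cs.length_simple]
  rw [Nat.even_iff] at hw
  omega

theorem rotation_mem_alternatingSubgroup (l : Fin 3) :
    rotation cs l ∈ alternatingSubgroup cs :=
  simple_mul_mem_alternatingSubgroup cs _ (simple_notMem_alternatingSubgroup cs _)

/-- The parabolic is dihedral: the powers of the rotation together with one coset of reflections,
which are odd. -/
theorem mem_zpowers_rotation {l : Fin 3} {w : W}
    (hw : w ∈ Subgroup.closure (cs.simple '' {i | i ≠ l})) (heven : w ∈ alternatingSubgroup cs) :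
    w ∈ Subgroup.zpowers (rotation cs l) := by
  have hle : Subgroup.zpowers (rotation cs l) ≤ alternatingSubgroup cs :=
    Subgroup.zpowers_le.mpr (rotation_mem_alternatingSubgroup cs l)
  have key : w ∈ Subgroup.zpowers (rotation cs l) ∨
      w * cs.simple (l + 1) ∈ Subgroup.zpowers (rotation cs l) := by
    have step : ∀ (x : W) (i : Fin 3), i ≠ l → (x ∈ Subgroup.zpowers (rotation cs l) ∨
        x * cs.simple (l + 1) ∈ Subgroup.zpowers (rotation cs l)) →
        (x * cs.simple i ∈ Subgroup.zpowers (rotation cs l) ∨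
          x * cs.simple i * cs.simple (l + 1) ∈ Subgroup.zpowers (rotation cs l)) := by
      intro x i hi hx
      have hi' := (eq_or_eq_add_one_or_eq_add_two i l).resolve_left hi
      have ha := Subgroup.mem_zpowers (rotation cs l)
      rcases hi' with rfl | rfl
      · rcases hx with hx | hx
        · exact .inr (by simpa using hx)
        · exact .inl hx
      · rcases hx with hx | hx
        · have := mul_mem hx (inv_mem ha)
          exact .inr (by simpa [rotation, mul_assoc] using this)
        · have := mul_mem hx ha
          exact .inl (by simpa [rotation, mul_assoc] using this)
    -- Evenness does not pass to prefixes of a word, so it stays out of the induction.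
    clear heven
    induction hw using Subgroup.closure_induction_right with
    | one => exact .inl (one_mem _)
    | mul_right x y hy hx ih =>
      obtain ⟨i, hi, rfl⟩ := hx
      exact step x i hi ih
    | mul_inv_cancel x y hy hx ih =>
      obtain ⟨i, hi, rfl⟩ := hx
      rw [inv_simple]
      exact step x i hi ih
  refine key.resolve_right fun h ↦ simple_notMem_alternatingSubgroup cs (l + 1) ?_
  have := mul_mem (inv_mem heven) (hle h)
  simpa using this

theorem eq_smul_proj {hM : ∀ i j, M i j ≠ 0} {l : Fin 3} {x : Dual ℝ (Fin 3 → ℝ)}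
    (h : (cs.geometricRep hM).dual (rotation cs l) x = x) :
    x = x (Pi.single l 1) • LinearMap.proj l := by
  obtain ⟨h1, h2⟩ := apply_eq_zero_of_dual_eq_self (add_one_ne_add_two l) h
  refine LinearMap.pi_ext' fun i ↦ LinearMap.ext_ring ?_
  rcases eq_or_eq_add_one_or_eq_add_two i l with rfl | rfl | rfl
  · simp
  · simp [h1]
  · simp [h2]

/-- The `i`-th rotation fixes `g · proj j`, which is thus `c · proj i`; each sign of `c` is
impossible. -/
theorem eq_of_conj_rotation_mem_zpowers [Infinite W] (hM : ∀ i j, M i j ≠ 0) {i j : Fin 3} {g : W}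
    (h : g⁻¹ * rotation cs i * g ∈ Subgroup.zpowers (rotation cs j)) : i = j := by
  by_contra hij
  set x := (cs.geometricRep hM).dual g (LinearMap.proj j) with hx
  have hproj : ∀ l a : Fin 3, 0 ≤ (LinearMap.proj l : Dual ℝ (Fin 3 → ℝ)) (Pi.single a 1) := by
    intro l a
    by_cases hl : l = a
    · subst hl; simp
    · simp [hl]
  have hfix : (cs.geometricRep hM).dual (rotation cs i) x = x := by
    have h1 := dual_proj_eq_self (hM := hM)
      (Subgroup.zpowers_le.mpr (rotation_mem_closure cs j) h)
    have h2 := congrArg ((cs.geometricRep hM).dual g) h1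
    rwa [← Module.End.mul_apply, ← map_mul, mul_assoc, mul_inv_cancel_left, map_mul,
      Module.End.mul_apply] at h2
  have hxc := eq_smul_proj cs hfix
  set c := x (Pi.single i 1)
  rcases lt_trichotomy c 0 with hc | hc | hc
  · have hneg : -LinearMap.proj i ∈ cs.titsCone hM := by
      have h1 := smul_mem_titsCone (cs := cs) (hM := hM) (dual_mem_titsCone g (dominant_mem_titsCone (hproj j)))
        (inv_nonneg.mpr (neg_nonneg.mpr hc.le))
      rw [← hx, hxc, smul_smul] at h1
      have h2 : (-c)⁻¹ * c = -1 := by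
        have := hc.ne
        field_simp
      rwa [h2, neg_one_smul] at h1
    have hfinite : Finite (Subgroup.zpowers (rotation cs i)) := by
      refine Nat.finite_of_card_ne_zero ?_
      rw [Nat.card_zpowers, rotation, orderOf_simple_mul_simple hM (add_one_ne_add_two i)]
      exact hM _ _
    have := Fintype.ofFinite (Subgroup.zpowers (rotation cs i))
    have hp := coordinateSum_single (B := Fin 3)
    have hy := eq_smul_proj cs (dual_orbitSum (hM := hM) (Subgroup.zpowers (rotation cs i))
      (coordinateSum (Fin 3)) (Subgroup.mem_zpowers _))
    have hU := orbitSum_sub_mem_titsCone (cs := cs) (hM := hM) (Subgroup.zpowers (rotation cs i))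
      (dominant_mem_titsCone (x := coordinateSum (Fin 3)) fun a ↦ by simp [hp])
    rw [hy] at hU
    set d := (∑ a : Subgroup.zpowers (rotation cs i),
      (cs.geometricRep hM).dual (a : W) (coordinateSum (Fin 3))) (Pi.single i 1)
    refine neg_notMem_titsCone (cs := cs) (hM := hM) (p := coordinateSum (Fin 3))
      (fun a ↦ by simp [hp]) ?_
    -- The orbit sum of `p` is `d · proj i`, and both `proj i` and `-proj i` lie in the cone. Either
    -- sign of `d` then gives `-p = (d · proj i - p) - d · proj i` in the cone.
    rcases le_total 0 d with hd | hd
    · convert add_mem_titsCone hU (smul_mem_titsCone hneg hd) using 1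
      module
    · convert add_mem_titsCone hU
        (smul_mem_titsCone (dominant_mem_titsCone (hproj i)) (neg_nonneg.mpr hd)) using 1
      module
  · rw [hc, zero_smul] at hxc
    have h1 := LinearMap.congr_fun hxc (cs.geometricRep hM g (Pi.single j 1))
    rw [hx, dual_apply_apply, geometricRep_inv_apply] at h1
    simp at h1
  -- Here both functionals are dominant, so they coincide; but `proj j` vanishes on the `i`-th root.
  · have h1 := (dual_eq_self_of_dominant (hM := hM) (w := g) (hproj j) fun a ↦ by
      rw [← hx, hxc]
      exact mul_nonneg hc.le (hproj i a)).1
    rw [← hx, hxc] at h1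
    have h2 := LinearMap.congr_fun h1 (Pi.single i 1)
    simp [Ne.symm hij] at h2
    exact hc.ne' h2

/-- The subgroup of the alternating subgroup generated by a rotation. -/
def rotationSubgroup (l : Fin 3) : Subgroup (alternatingSubgroup cs) :=
  Subgroup.zpowers ⟨rotation cs l, rotation_mem_alternatingSubgroup cs l⟩

theorem exists_le_conj_rotationSubgroup [Infinite W] (hM : ∀ i j, M i j ≠ 0)
    (H : Subgroup (alternatingSubgroup cs)) [Finite H] :
    ∃ l g, H ≤ (rotationSubgroup cs l).map (MulAut.conj g).toMonoidHom := by
  have : Finite (H.map (alternatingSubgroup cs).subtype) :=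
    Finite.of_equiv _ (H.equivMapOfInjective _ (Subgroup.subtype_injective _)).toEquiv
  obtain ⟨w, l, hw⟩ := exists_conj_mem_parabolic (cs := cs) hM
    (H.map (alternatingSubgroup cs).subtype)
  obtain ⟨u, hu, hu'⟩ : ∃ u ∈ alternatingSubgroup cs,
      ∀ h ∈ H.map (alternatingSubgroup cs).subtype,
        u * h * u⁻¹ ∈ Subgroup.closure (cs.simple '' {i | i ≠ l}) := by
    by_cases hmem : w ∈ alternatingSubgroup cs
    · exact ⟨w, hmem, hw⟩
    -- An odd conjugator is made even by a reflection of the parabolic itself.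
    · refine ⟨_, simple_mul_mem_alternatingSubgroup cs (l + 1) hmem, fun h hh ↦ ?_⟩
      have hs : cs.simple (l + 1) ∈ Subgroup.closure (cs.simple '' {i | i ≠ l}) :=
        Subgroup.subset_closure ⟨l + 1, by simp, rfl⟩
      have := mul_mem (mul_mem hs (hw h hh)) (inv_mem hs)
      simpa [mul_assoc] using this
  refine ⟨l, (⟨u, hu⟩ : alternatingSubgroup cs)⁻¹, fun h hh ↦ ?_⟩
  obtain ⟨q, hq⟩ := mem_zpowers_rotation cs (hu' h ⟨h, hh, rfl⟩)
    (mul_mem (mul_mem hu h.2) (inv_mem hu))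
  refine ⟨_, ⟨q, rfl⟩, Subtype.ext ?_⟩
  simp only at hq
  simp [hq, mul_assoc]

theorem eq_of_rotationSubgroup_le_conj [Infinite W] (hM : ∀ i j, M i j ≠ 0) (i j : Fin 3)
    (g : alternatingSubgroup cs)
    (h : rotationSubgroup cs i ≤ (rotationSubgroup cs j).map (MulAut.conj g).toMonoidHom) :
    i = j := by
  obtain ⟨_, ⟨q, rfl⟩, hq⟩ := h (Subgroup.mem_zpowers _)
  refine eq_of_conj_rotation_mem_zpowers cs hM (g := (g : W)) ⟨q, ?_⟩
  have := congrArg Subtype.val hq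
  simp at this
  simp [← this, mul_assoc]

theorem orderOf_rotation (hM : ∀ i j, M i j ≠ 0) (l : Fin 3) :
    orderOf (⟨rotation cs l, rotation_mem_alternatingSubgroup cs l⟩ : alternatingSubgroup cs) =
      M (l + 1) (l + 2) := by
  rw [Subgroup.orderOf_mk]
  exact orderOf_simple_mul_simple hM (add_one_ne_add_two l)

theorem finite_rotationSubgroup (hM : ∀ i j, M i j ≠ 0) (l : Fin 3) :
    Finite (rotationSubgroup cs l) := by
  refine Nat.finite_of_card_ne_zero ?_
  rw [rotationSubgroup, Nat.card_zpowers, orderOf_rotation cs hM]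
  exact hM _ _

end TriangleCoxeter

/-! ### The three classes -/

theorem proposition4 (k n m : ℕ) (hk : 2 ≤ k) (hn : 2 ≤ n) (hm : 2 ≤ m)
    (hW : Infinite (TriangleCoxeter.W k n m hk hn hm)) :
    ∃ C₁ C₂ C₃ : Set (Subgroup (TriangleCoxeter.Wplus k n m hk hn hm)),
      C₁ ≠ C₂ ∧ C₁ ≠ C₃ ∧ C₂ ≠ C₃ ∧
      TriangleCoxeter.maximalFiniteClasses (TriangleCoxeter.Wplus k n m hk hn hm) =
        {C₁, C₂, C₃} ∧
      (∀ H ∈ C₁, Nonempty (H ≃* Multiplicative (ZMod k))) ∧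
      (∀ H ∈ C₂, Nonempty (H ≃* Multiplicative (ZMod n))) ∧
      (∀ H ∈ C₃, Nonempty (H ≃* Multiplicative (ZMod m))) := by
  set M := TriangleCoxeter.matrix k n m hk hn hm
  set cs := M.toCoxeterSystem
  have hM : ∀ i j, M i j ≠ 0 := by
    intro i j
    fin_cases i <;> fin_cases j <;> simp [M, TriangleCoxeter.matrix] <;> omega
  have hne := TriangleCoxeter.eq_of_rotationSubgroup_le_conj cs hM
  have hinj := TriangleCoxeter.conjClass_injective hne
  have hord := TriangleCoxeter.orderOf_rotation cs hM
  -- With indices modulo 3, rotations 2, 0, 1 are `r₁r₂`, `r₂r₃`, `r₃r₁`, of orders `k`, `n`, `m`.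
  refine ⟨TriangleCoxeter.conjClass (TriangleCoxeter.rotationSubgroup cs 2),
    TriangleCoxeter.conjClass (TriangleCoxeter.rotationSubgroup cs 0),
    TriangleCoxeter.conjClass (TriangleCoxeter.rotationSubgroup cs 1),
    hinj.ne (by decide), hinj.ne (by decide), hinj.ne (by decide), ?_,
    fun H hH ↦ TriangleCoxeter.nonempty_mulEquiv_zmod (hord 2) hH,
    fun H hH ↦ TriangleCoxeter.nonempty_mulEquiv_zmod (hord 0) hH,
    fun H hH ↦ TriangleCoxeter.nonempty_mulEquiv_zmod (hord 1) hH⟩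
  refine (TriangleCoxeter.maximalFiniteClasses_eq_range
    (TriangleCoxeter.finite_rotationSubgroup cs hM)
    (fun H hH ↦ TriangleCoxeter.exists_le_conj_rotationSubgroup cs hM H) hne).trans ?_
  ext C
  constructor
  · rintro ⟨i, rfl⟩
    fin_cases i
    exacts [.inr (.inl rfl), .inr (.inr rfl), .inl rfl]
  · rintro (rfl | rfl | rfl)
    exacts [⟨2, rfl⟩, ⟨0, rfl⟩, ⟨1, rfl⟩]
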